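/- Let $1\le K\le N$, $\alpha>2$, $\sigma>0$ and $\mu_1,\dots,\mu_N\in\mathbb{R}$. There are $K$ agents and $N$ goods (arms); the true reward of good $i$ is $\mu_i$ for every agent. Pulling arm $i$ at epoch $t$ yields the noisy reward $X_i(t)=\mu_i+\epsilon_i(t)$, where the noise vectors $\epsilon(t)=(\epsilon_i(t))_{i\le N}$ are independent and identically distributed across $t$ and every $\epsilon_i(t)$ is $\sigma^2$-subgaussian with mean $0$, i.e. $\mathbb{E}\,e^{\lambda\epsilon_i(t)}\le e^{\lambda^2\sigma^2/2}$ for all $\lambda\in\mathbb{R}$. An allocation is an injective map $\phi:\{1,\dots,K\}\to\{1,\dots,N\}$. The Dueling ULCB algorithm pulls each arm once during the epochs $1,\dots,N$, in a fixed order, while outputting arbitrary fixed allocations $\phi_t$. At each epoch $t>N$, let $T_i(t-1)$ be the number of earlier pulls of arm $i$, let $\hat\mu_i(t)$ be the average of the rewards observed in these pulls, and let $$\bar\nu_i(t)=\hat\mu_i(t)+\sqrt{\tfrac{2\sigma^2\log t^{\alpha}}{T_i(t-1)}},\qquad \underline\nu_i(t)=\hat\mu_i(t)-\sqrt{\tfrac{2\sigma^2\log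 t^{\alpha}}{T_i(t-1)}}.$$ The algorithm outputs an allocation $\phi_t\in\arg\max_\phi\min_j\bar\nu_{\phi(j)}(t)$ (for instance one whose image is the set of the arms with the $K$ largest values $\bar\nu_i(t)$), then pulls the arm with the lowest $\underline\nu_i(t)$ among $\phi_t(1),\dots,\phi_t(K)$ and observes its noisy reward only. Ties are broken by fixed measurable rules. The expected cumulative regret is $$R_T=\mathbb{E}\Big[\sum_{t=1}^{T}\Big(\max_{\phi}\min_{j}\mu_{\phi(j)}-\min_{j}\mu_{\phi_t(j)}\Big)\Big].$$ Let $\mu_{(K)}$ be the $K$-th largest of $\mu_1,\dots,\mu_N$ (with multiplicity), $\Delta_i(K)=|\mu_{(K)}-\mu_i|$ and $G(0)=\{i:\mu_{(K)}-\mu_i>0\}$. Then for every $T>N$ the cumulative regret is integrable and $$R_T\le 2\sqrt{\big((N-K+1)^2-1\big)\,K\,8\sigma^2\alpha\,T\log T}+\sum_{i\in G(0)}\left(\frac{2K\,\Delta_i(K)\,\alpha}{\alpha-2}+\frac{(N-K)K\,\Delta_i(K)\,\alpha}{\alpha-2}\right).$$ In particular, $R_T=O(\sqrt{T\log T})$ as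 $T\to\infty$. -/

import Mathlib

open MeasureTheory ProbabilityTheory Filter Asymptotics
open scoped NNReal

noncomputable section

namespace MaxMinBandit

/-- An allocation of one good to each of `K` agents, distinct agents receiving distinct goods. -/
abbrev Allocation (K N : ℕ) := Fin K ↪ Fin N

/-- The reward of the lowest-rewarded agent under `φ`, when `x j i` is the reward of agent `j`
for good `i`. -/
def minReward {K N : ℕ} (x : Fin K → Fin N → ℝ) (φ : Allocation K N) : ℝ :=
  ⨅ j, x j (φ j)

/-- The optimal max-min objective. -/
def maxMin {K N : ℕ} (x : Fin K → Fin N → ℝ) : ℝ :=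
  ⨆ φ : Allocation K N, minReward x φ

/-- What the learner remembers: for each arm, the number of pulls so far and the sum of the
noisy rewards collected by these pulls. -/
structure State (N : ℕ) where
  count : Fin N → ℕ
  total : Fin N → ℝ

namespace State

variable {N : ℕ}

/-- Nothing has been pulled yet. -/
def init (N : ℕ) : State N := ⟨fun _ => 0, fun _ => 0⟩

/-- The state after pulling arm `a` and observing the noisy reward `x`. -/
def pull (s : State N) (a : Fin N) (x : ℝ) : State N :=
  ⟨fun i => if i = a then s.count i + 1 else s.count i,
   fun i => if i = a then s.total i + x else s.total i⟩

/-- The average of the collected noisy rewards of arm `i`. -/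
def mean (s : State N) (i : Fin N) : ℝ := s.total i / s.count i

/-- Half the width of the confidence interval of arm `i` at epoch `t`; here `s` is the state
before the pull of epoch `t`. -/
def bonus (α σ : ℝ) (s : State N) (t : ℕ) (i : Fin N) : ℝ :=
  √(1 / (s.count i : ℝ) * (2 * σ ^ 2 * Real.log ((t : ℝ) ^ α)))

/-- Upper confidence bound of arm `i` at epoch `t`. -/
def ucb (α σ : ℝ) (s : State N) (t : ℕ) (i : Fin N) : ℝ := s.mean i + s.bonus α σ t i

/-- Lower confidence bound of arm `i` at epoch `t`. -/
def lcb (α σ : ℝ) (s : State N) (t : ℕ) (i : Fin N) : ℝ := s.mean i - s.bonus α σ t i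

end State

/-- The free choices of the Dueling ULCB algorithm: the two oracles (that is, how ties are
broken), the order in which the arms are pulled during the first `N` epochs, and the
allocations that are output during these first `N` epochs. -/
structure DuelingULCB (K N : ℕ) where
  /-- The first oracle solves the static max-min problem. -/
  oracle₁ : (Fin K → Fin N → ℝ) → Allocation K N
  oracle₁_max : ∀ x φ, minReward x φ ≤ minReward x (oracle₁ x)
  oracle₁_meas : ∀ φ, MeasurableSet {x | oracle₁ x = φ}
  /-- The second oracle returns the agent with the lowest value within a given allocation. -/
  oracle₂ : Allocation K N → (Fin K → Fin N → ℝ) → Fin K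
  oracle₂_min : ∀ (φ : Allocation K N) (x : Fin K → Fin N → ℝ) (j : Fin K),
    x (oracle₂ φ x) (φ (oracle₂ φ x)) ≤ x j (φ j)
  oracle₂_meas : ∀ φ j, MeasurableSet {x | oracle₂ φ x = j}
  initOrder : Equiv.Perm (Fin N)
  initAlloc : Fin N → Allocation K N

namespace DuelingULCB

variable {K N : ℕ}

/-- The allocation `φ_t` output at epoch `t = n + 1`, when `s` is the state after the first `n`
epochs: once every arm has been pulled, it is a max-min allocation for the UCB values. -/
def alloc (A : DuelingULCB K N) (α σ : ℝ) (s : State N) (n : ℕ) : Allocation K N :=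
  if h : n < N then A.initAlloc ⟨n, h⟩ else A.oracle₁ (fun _ i => s.ucb α σ (n + 1) i)

/-- The arm `I_t` pulled at epoch `t = n + 1`, when `s` is the state after the first `n` epochs:
once every arm has been pulled, it is the arm with the lowest LCB within `φ_t`. -/
def arm (A : DuelingULCB K N) (α σ : ℝ) (s : State N) (n : ℕ) : Fin N :=
  if h : n < N then A.initOrder ⟨n, h⟩
  else (A.alloc α σ s n)
    (A.oracle₂ (A.alloc α σ s n) (fun _ i => s.lcb α σ (n + 1) i))

/-- The state after the first `n` epochs, when `X t i` is the noisy reward that a pull of arm `i`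
at epoch `t` yields. Only the reward of the pulled arm is ever observed. -/
def run (A : DuelingULCB K N) (α σ : ℝ) (X : ℕ → Fin N → ℝ) : ℕ → State N
  | 0 => State.init N
  | n + 1 =>
    (A.run α σ X n).pull (A.arm α σ (A.run α σ X n) n)
      (X (n + 1) (A.arm α σ (A.run α σ X n) n))

/-- The cumulative regret of one run over the epochs `1, …, T`, for the true rewards `ρ j i`. -/
def cumRegret (A : DuelingULCB K N) (α σ : ℝ) (ρ : Fin K → Fin N → ℝ) (X : ℕ → Fin N → ℝ)
    (T : ℕ) : ℝ :=
  ∑ n ∈ Finset.range T, (maxMin ρ - minReward ρ (A.alloc α σ (A.run α σ X n) n))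

end DuelingULCB

/-- The `K`-th largest of the rewards `μ i`, counted with multiplicity. -/
def kthLargest {N : ℕ} (μ : Fin N → ℝ) (K : ℕ) (hK : 0 < K) (hKN : K ≤ N) : ℝ :=
  μ (Tuple.sort μ ⟨N - K, by omega⟩)

/-- `Δ_i(K)`, the distance of `μ i` from the `K`-th largest reward. -/
def gap {N : ℕ} (μ : Fin N → ℝ) (K : ℕ) (hK : 0 < K) (hKN : K ≤ N) (i : Fin N) : ℝ :=
  |kthLargest μ K hK hKN - μ i|

/-- `G(δ)`, the arms whose reward is more than `δ` below the `K`-th largest reward. -/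
def badArms {N : ℕ} (μ : Fin N → ℝ) (K : ℕ) (hK : 0 < K) (hKN : K ≤ N) (δ : ℝ) :
    Finset (Fin N) :=
  Finset.univ.filter (fun i => kthLargest μ K hK hKN - μ i > δ)

end MaxMinBandit

end

namespace MaxMinBandit

/-- A random state all of whose counts and totals are measurable. -/
structure MeasurableState {Ω : Type*} {N : ℕ} (m : MeasurableSpace Ω) (s : Ω → State N) :
    Prop where
  count : ∀ i, Measurable[m] fun ω => (s ω).count i
  total : ∀ i, Measurable[m] fun ω => (s ω).total i

namespace MeasurableState

variable {Ω : Type*} {K N : ℕ} {m : MeasurableSpace Ω} {s : Ω → State N}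

lemma mono {m' : MeasurableSpace Ω} (h : MeasurableState m s) (hm : m ≤ m') :
    MeasurableState m' s :=
  ⟨fun i => (h.count i).mono hm le_rfl, fun i => (h.total i).mono hm le_rfl⟩

lemma count_cast (h : MeasurableState m s) (i : Fin N) :
    Measurable fun ω => ((s ω).count i : ℝ) :=
  (measurable_from_top (f := fun k : ℕ => (k : ℝ))).comp (h.count i)

lemma mean (h : MeasurableState m s) (i : Fin N) : Measurable fun ω => (s ω).mean i :=
  (h.total i).div (h.count_cast i)

lemma bonus (h : MeasurableState m s) (α σ : ℝ) (t : ℕ) (i : Fin N) :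
    Measurable fun ω => (s ω).bonus α σ t i :=
  (((h.count_cast i).const_div 1).mul_const _).sqrt

lemma ucb (h : MeasurableState m s) (α σ : ℝ) (t : ℕ) :
    Measurable fun ω => (fun (_ : Fin K) i => (s ω).ucb α σ t i) :=
  measurable_pi_lambda _ fun _ => measurable_pi_lambda _ fun i =>
    (h.mean i).add (h.bonus α σ t i)

lemma lcb (h : MeasurableState m s) (α σ : ℝ) (t : ℕ) :
    Measurable fun ω => (fun (_ : Fin K) i => (s ω).lcb α σ t i) :=
  measurable_pi_lambda _ fun _ => measurable_pi_lambda _ fun i =>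
    (h.mean i).sub (h.bonus α σ t i)

lemma measurableSet_alloc (h : MeasurableState m s) (A : DuelingULCB K N) (α σ : ℝ) (n : ℕ)
    (φ : Allocation K N) : MeasurableSet {ω | A.alloc α σ (s ω) n = φ} := by
  unfold DuelingULCB.alloc
  split_ifs with hn
  · exact MeasurableSet.const _
  · exact h.ucb α σ (n + 1) (A.oracle₁_meas φ)

lemma measurableSet_arm (h : MeasurableState m s) (A : DuelingULCB K N) (α σ : ℝ) (n : ℕ)
    (a : Fin N) : MeasurableSet {ω | A.arm α σ (s ω) n = a} := by
  by_cases hn : n < N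
  · simp only [DuelingULCB.arm, hn, dif_pos]
    exact MeasurableSet.const _
  · have : {ω | A.arm α σ (s ω) n = a} = ⋃ (φ : Allocation K N), ⋃ (j : Fin K),
        ({ω | A.alloc α σ (s ω) n = φ} ∩
          ({ω | A.oracle₂ φ (fun _ i => (s ω).lcb α σ (n + 1) i) = j} ∩ {_ω | φ j = a})) := by
      ext ω
      simp [DuelingULCB.arm, hn]
    rw [this]
    exact MeasurableSet.iUnion fun φ => MeasurableSet.iUnion fun j =>
      (h.measurableSet_alloc A α σ n φ).inter
        ((h.lcb α σ (n + 1) (A.oracle₂_meas φ j)).inter (MeasurableSet.const _))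

lemma pull (h : MeasurableState m s) {a : Ω → Fin N} {x : Ω → Fin N → ℝ}
    (ha : ∀ i, MeasurableSet {ω | a ω = i}) (hx : Measurable x) :
    MeasurableState m fun ω => (s ω).pull (a ω) (x ω (a ω)) := by
  have ha' (i : Fin N) : MeasurableSet {ω | i = a ω} := by simpa [eq_comm] using ha i
  refine ⟨fun i => Measurable.ite (ha' i) ((h.count i).add_const 1) (h.count i), fun i => ?_⟩
  have : (fun ω => ((s ω).pull (a ω) (x ω (a ω))).total i) =
      fun ω => if i = a ω then (s ω).total i + x ω i else (s ω).total i := by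
    funext ω
    by_cases hi : i = a ω
    · simp [State.pull, ← hi]
    · simp [State.pull, hi]
  rw [this]
  exact Measurable.ite (ha' i) ((h.total i).add ((measurable_pi_apply i).comp hx)) (h.total i)

end MeasurableState

section History

variable {Ω : Type*} {N : ℕ}

/-- The information carried by the noise of the epochs up to `n`. -/
@[reducible] def history (ε : ℕ → Ω → Fin N → ℝ) (n : ℕ) : MeasurableSpace Ω :=
  ⨆ k ∈ Set.Iic n, MeasurableSpace.comap (ε k) inferInstance

lemma comap_le_history (ε : ℕ → Ω → Fin N → ℝ) {k n : ℕ} (h : k ≤ n) :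
    MeasurableSpace.comap (ε k) inferInstance ≤ history ε n :=
  le_iSup₂_of_le k h le_rfl

lemma history_mono (ε : ℕ → Ω → Fin N → ℝ) {k n : ℕ} (h : k ≤ n) :
    history ε k ≤ history ε n :=
  biSup_mono fun _ hi => le_trans hi h

lemma history_le [mΩ : MeasurableSpace Ω] {ε : ℕ → Ω → Fin N → ℝ} (hε : ∀ t, Measurable (ε t))
    (n : ℕ) : history ε n ≤ mΩ :=
  iSup₂_le fun k _ => (hε k).comap_le

lemma indep_history [MeasurableSpace Ω] {P : Measure Ω} {ε : ℕ → Ω → Fin N → ℝ}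
    (hε : ∀ t, Measurable (ε t)) (hindep : iIndepFun ε P) (n : ℕ) :
    Indep (history ε n) (MeasurableSpace.comap (ε (n + 1)) inferInstance) P := by
  have h := indep_iSup_of_disjoint (fun k => (hε k).comap_le) hindep.iIndep
    (S := Set.Iic n) (T := {n + 1}) (by simp)
  simpa [history] using h

end History

section Concentration

variable {Ω : Type*} {K N : ℕ}

lemma measurableState_run (A : DuelingULCB K N) (α σ : ℝ) (μ : Fin N → ℝ)
    (ε : ℕ → Ω → Fin N → ℝ) (n : ℕ) :
    MeasurableState (history ε n) fun ω => A.run α σ (fun t i => μ i + ε t ω i) n := by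
  induction n with
  | zero => exact ⟨fun _ => measurable_const, fun _ => measurable_const⟩
  | succ n ih =>
    have ih' := ih.mono (history_mono ε n.le_succ)
    refine ih'.pull (fun i => ih'.measurableSet_arm A α σ n i)
      (x := fun ω i => μ i + ε (n + 1) ω i) ?_
    have he : Measurable[history ε (n + 1)] (ε (n + 1)) :=
      Measurable.of_comap_le (comap_le_history ε le_rfl)
    let := history ε (n + 1)
    exact measurable_pi_lambda _ fun i => ((measurable_pi_apply i).comp he).const_add (μ i)

/-- The exponential supermartingale of arm `i` with true reward `ρ`. -/
noncomputable def expPot (σ l ρ : ℝ) (s : State N) (i : Fin N) : ℝ :=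
  Real.exp (l * (s.total i - ρ * s.count i) - l ^ 2 * σ ^ 2 / 2 * s.count i)

lemma expPot_pos (σ l ρ : ℝ) (s : State N) (i : Fin N) : 0 < expPot σ l ρ s i :=
  Real.exp_pos _

lemma expPot_pull (σ l : ℝ) (μ : Fin N → ℝ) (s : State N) (i a : Fin N) (e : Fin N → ℝ) :
    expPot σ l (μ i) (s.pull a (μ a + e a)) i =
      expPot σ l (μ i) s i * if a = i then Real.exp (l * e i - l ^ 2 * σ ^ 2 / 2) else 1 := by
  by_cases h : a = i
  · subst h
    simp only [expPot, State.pull, if_true, ← Real.exp_add]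
    congr 1
    push_cast
    ring
  · simp [expPot, State.pull, h, Ne.symm h]

lemma MeasurableState.expPot {m : MeasurableSpace Ω} {s : Ω → State N} (h : MeasurableState m s)
    (σ l ρ : ℝ) (i : Fin N) : Measurable fun ω => expPot σ l ρ (s ω) i :=
  ((((h.total i).sub ((h.count_cast i).const_mul ρ)).const_mul l).sub
    ((h.count_cast i).const_mul _)).exp

variable [MeasurableSpace Ω] {P : Measure Ω}

lemma lintegral_exp_subgaussian_le_one {σ : ℝ≥0} {X : Ω → ℝ}
    (h : HasSubgaussianMGF X (σ ^ 2) P) (l : ℝ) :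
    ∫⁻ ω, ENNReal.ofReal (Real.exp (l * X ω - l ^ 2 * (σ : ℝ) ^ 2 / 2)) ∂P ≤ 1 := by
  have he (ω : Ω) : Real.exp (l * X ω - l ^ 2 * (σ : ℝ) ^ 2 / 2) =
      Real.exp (l * X ω) * Real.exp (-(l ^ 2 * (σ : ℝ) ^ 2 / 2)) := by
    rw [← Real.exp_add, sub_eq_add_neg]
  simp_rw [he]
  rw [← ofReal_integral_eq_lintegral_ofReal ((h.integrable_exp_mul l).mul_const _)
    (ae_of_all _ fun ω => by positivity), integral_mul_const, ← ENNReal.ofReal_one]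
  refine ENNReal.ofReal_le_ofReal ?_
  have hm := h.mgf_le l
  calc _ ≤ Real.exp (((σ ^ 2 : ℝ≥0) : ℝ) * l ^ 2 / 2) * Real.exp (-(l ^ 2 * (σ : ℝ) ^ 2 / 2)) :=
        mul_le_mul_of_nonneg_right hm (Real.exp_pos _).le
    _ = 1 := by
        rw [← Real.exp_add, Real.exp_eq_one_iff]
        push_cast
        ring

variable [IsProbabilityMeasure P] {ε : ℕ → Ω → Fin N → ℝ} {σ : ℝ≥0}

lemma lintegral_expPot_run_le_one (hmeas : ∀ t, Measurable (ε t)) (hindep : iIndepFun ε P)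
    (hsub : ∀ t i, HasSubgaussianMGF (fun ω => ε t ω i) (σ ^ 2) P)
    (A : DuelingULCB K N) (α : ℝ) (μ : Fin N → ℝ) (l : ℝ) (i : Fin N) (n : ℕ) :
    ∫⁻ ω, ENNReal.ofReal
      (expPot σ l (μ i) (A.run α σ (fun t i => μ i + ε t ω i) n) i) ∂P ≤ 1 := by
  induction n with
  | zero => simp [DuelingULCB.run, State.init, expPot]
  | succ n ih =>
    set s : Ω → State N := fun ω => A.run α σ (fun t i => μ i + ε t ω i) n with hs
    have hst : MeasurableState (history ε n) s := measurableState_run A α σ μ ε n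
    set Z : Ω → ENNReal := fun ω => ENNReal.ofReal (expPot σ l (μ i) (s ω) i) with hZ
    have hZm : Measurable[history ε n] Z := (hst.expPot σ l (μ i) i).ennreal_ofReal
    set E : Set Ω := {ω | A.arm α σ (s ω) n = i} with hE
    have hEm : MeasurableSet[history ε n] E := hst.measurableSet_arm A α σ n i
    set Y : Ω → ENNReal := fun ω =>
      ENNReal.ofReal (Real.exp (l * ε (n + 1) ω i - l ^ 2 * (σ : ℝ) ^ 2 / 2)) with hY
    have hYm : Measurable[MeasurableSpace.comap (ε (n + 1)) inferInstance] Y := by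
      have := (measurable_pi_apply i).comp (comap_measurable (ε (n + 1)))
      exact ((this.const_mul l).sub_const _).exp.ennreal_ofReal
    have hle := history_le hmeas n
    have key (ω : Ω) : ENNReal.ofReal
        (expPot σ l (μ i) (A.run α σ (fun t i => μ i + ε t ω i) (n + 1)) i) =
        E.indicator Z ω * Y ω + Eᶜ.indicator Z ω := by
      have h1 : A.run α σ (fun t i => μ i + ε t ω i) (n + 1) =
          (s ω).pull (A.arm α σ (s ω) n)
            (μ (A.arm α σ (s ω) n) + ε (n + 1) ω (A.arm α σ (s ω) n)) := rfl
      rw [h1, expPot_pull, ENNReal.ofReal_mul (expPot_pos ..).le]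
      by_cases hω : A.arm α σ (s ω) n = i
      · have : ω ∈ E := hω
        simp [this, hω, Z, Y]
      · have : ω ∉ E := hω
        simp [this, hω, Z]
    simp_rw [key]
    have hm1 : Measurable (E.indicator Z) := (hZm.indicator hEm).mono hle le_rfl
    rw [lintegral_add_right _ ((hZm.indicator hEm.compl).mono hle le_rfl),
      lintegral_mul_eq_lintegral_mul_lintegral_of_independent_measurableSpace hle
        (hmeas (n + 1)).comap_le (indep_history hmeas hindep n) (hZm.indicator hEm) hYm]
    calc _ ≤ (∫⁻ ω, E.indicator Z ω ∂P) * 1 + ∫⁻ ω, Eᶜ.indicator Z ω ∂P := by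
          gcongr
          exact lintegral_exp_subgaussian_le_one (hsub (n + 1) i) l
      _ = ∫⁻ ω, Z ω ∂P := by
          rw [mul_one, lintegral_indicator (hle _ hEm), lintegral_indicator (hle _ hEm.compl),
            lintegral_add_compl _ (hle _ hEm)]
      _ ≤ 1 := ih

lemma measureReal_expPot_ge (hmeas : ∀ t, Measurable (ε t)) (hindep : iIndepFun ε P)
    (hsub : ∀ t i, HasSubgaussianMGF (fun ω => ε t ω i) (σ ^ 2) P)
    (A : DuelingULCB K N) (α : ℝ) (μ : Fin N → ℝ) (l L : ℝ) (i : Fin N) (n : ℕ) :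
    P.real {ω | Real.exp L ≤ expPot σ l (μ i) (A.run α σ (fun t i => μ i + ε t ω i) n) i} ≤
      Real.exp (-L) := by
  have hm := (((measurableState_run A α σ μ ε n).mono (history_le hmeas n)).expPot
    (σ : ℝ) l (μ i) i).ennreal_ofReal
  have h := (mul_meas_ge_le_lintegral (μ := P) hm (ENNReal.ofReal (Real.exp L))).trans
    (lintegral_expPot_run_le_one hmeas hindep hsub A α μ l i n)
  simp_rw [ENNReal.ofReal_le_ofReal_iff (expPot_pos ..).le] at h
  have h' := ENNReal.toReal_mono ENNReal.one_ne_top h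
  rw [ENNReal.toReal_mul, ENNReal.toReal_ofReal (Real.exp_pos _).le, ENNReal.toReal_one] at h'
  rw [Real.exp_neg, ← one_div, le_div_iff₀ (Real.exp_pos _), mul_comm]
  exact h'

end Concentration

/-- Some arm's empirical mean leaves its confidence interval. -/
def Deviates {N : ℕ} (α σ : ℝ) (μ : Fin N → ℝ) (s : State N) (t : ℕ) : Prop :=
  ∃ i, s.bonus α σ t i < |s.mean i - μ i|

lemma exp_le_expPot_of_bonus_lt {N : ℕ} {α σ ρ : ℝ} {s : State N} {t : ℕ} {i : Fin N}
    (hσ : 0 < σ) (hL : 0 ≤ Real.log ((t : ℝ) ^ α)) (hc : 0 < s.count i)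
    (h : s.bonus α σ t i < |s.mean i - ρ|) :
    Real.exp (Real.log ((t : ℝ) ^ α)) ≤
        expPot σ (√(2 * Real.log ((t : ℝ) ^ α) / (s.count i * σ ^ 2))) ρ s i ∨
      Real.exp (Real.log ((t : ℝ) ^ α)) ≤
        expPot σ (-√(2 * Real.log ((t : ℝ) ^ α) / (s.count i * σ ^ 2))) ρ s i := by
  unfold State.bonus State.mean at h
  unfold expPot
  set L := Real.log ((t : ℝ) ^ α)
  have hc' : (0 : ℝ) < s.count i := by exact_mod_cast hc
  set c : ℝ := (s.count i : ℝ)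
  set l := √(2 * L / (c * σ ^ 2)) with hl
  have hl0 : 0 ≤ l := Real.sqrt_nonneg _
  have hl2 : l ^ 2 = 2 * L / (c * σ ^ 2) := Real.sq_sqrt (by positivity)
  have hb : √(1 / c * (2 * σ ^ 2 * L)) = l * σ ^ 2 := by
    rw [show 1 / c * (2 * σ ^ 2 * L) = (l * σ ^ 2) ^ 2 by rw [mul_pow, hl2]; field_simp,
      Real.sqrt_sq (by positivity)]
  have hLl : L = l ^ 2 * σ ^ 2 / 2 * c := by rw [hl2]; field_simp
  rw [hb] at h
  simp only [Real.exp_le_exp, neg_sq]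
  have hS : s.total i - ρ * c = (s.total i / c - ρ) * c := by field_simp
  rw [hS]
  rcases lt_abs.1 h with h | h
  · left
    have := mul_le_mul_of_nonneg_left h.le (mul_nonneg hl0 hc'.le)
    linarith [this, hLl]
  · right
    have := mul_le_mul_of_nonneg_left h.le (mul_nonneg hl0 hc'.le)
    linarith [this, hLl]

end MaxMinBandit

namespace MaxMinBandit

section StaticProblem

variable {K N : ℕ}

lemma minReward_le (x : Fin K → Fin N → ℝ) (φ : Allocation K N) (j : Fin K) :
    minReward x φ ≤ x j (φ j) :=
  ciInf_le (Set.finite_range _).bddBelow j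

lemma minReward_le_maxMin (x : Fin K → Fin N → ℝ) (φ : Allocation K N) :
    minReward x φ ≤ maxMin x :=
  le_ciSup (f := fun φ : Allocation K N => minReward x φ) (Set.finite_range _).bddAbove φ

lemma exists_apply_le_kthLargest (μ : Fin N → ℝ) (hK : 0 < K) (hKN : K ≤ N)
    (φ : Allocation K N) : ∃ j, μ (φ j) ≤ kthLargest μ K hK hKN := by
  by_contra! h
  have hlt (j : Fin K) : N - K < ((Tuple.sort μ).symm (φ j) : ℕ) := by
    by_contra! hle
    have := Tuple.monotone_sort μ
      (show (Tuple.sort μ).symm (φ j) ≤ ⟨N - K, by omega⟩ from hle)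
    simp only [Function.comp_apply, Equiv.apply_symm_apply] at this
    exact absurd (h j) (not_lt.2 this)
  have hcard := Finset.card_le_card_of_injOn (s := (Finset.univ : Finset (Fin K)))
    (t := Finset.Ioo (N - K) N) (fun j => ((Tuple.sort μ).symm (φ j) : ℕ))
    (fun j _ => by simpa using hlt j)
    (fun j _ k _ hjk => φ.injective ((Tuple.sort μ).symm.injective (Fin.ext hjk)))
  simp at hcard
  omega

lemma maxMin_le_kthLargest (μ : Fin N → ℝ) (hK : 0 < K) (hKN : K ≤ N) :
    maxMin (fun _ : Fin K => μ) ≤ kthLargest μ K hK hKN := by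
  have : Nonempty (Allocation K N) := ⟨Fin.castLEEmb hKN⟩
  refine ciSup_le fun φ => ?_
  obtain ⟨j, hj⟩ := exists_apply_le_kthLargest μ hK hKN φ
  exact (minReward_le _ φ j).trans hj

lemma gap_nonneg (μ : Fin N → ℝ) (hK : 0 < K) (hKN : K ≤ N) (i : Fin N) :
    0 ≤ gap μ K hK hKN i :=
  abs_nonneg _

/-- The regret of a single allocation is at most the sum of the gaps of the bad arms. -/
lemma maxMin_sub_minReward_le (μ : Fin N → ℝ) (hK : 0 < K) (hKN : K ≤ N)
    (φ : Allocation K N) :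
    maxMin (fun _ : Fin K => μ) - minReward (fun _ => μ) φ ≤
      ∑ i ∈ badArms μ K hK hKN 0, gap μ K hK hKN i := by
  have : Nonempty (Fin K) := ⟨⟨0, hK⟩⟩
  obtain ⟨j, hj⟩ := exists_eq_ciInf_of_finite (f := fun j => μ (φ j))
  have hj' : minReward (fun _ => μ) φ = μ (φ j) := hj.symm
  have hle : maxMin (fun _ : Fin K => μ) - minReward (fun _ => μ) φ ≤
      kthLargest μ K hK hKN - μ (φ j) := by
    rw [hj']
    exact sub_le_sub_right (maxMin_le_kthLargest μ hK hKN) _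
  by_cases hb : φ j ∈ badArms μ K hK hKN 0
  · exact (hle.trans (le_abs_self _)).trans (Finset.single_le_sum
      (f := gap μ K hK hKN) (fun i _ => gap_nonneg μ hK hKN i) hb)
  · have : kthLargest μ K hK hKN - μ (φ j) ≤ 0 := by simpa [badArms] using hb
    exact (hle.trans this).trans (Finset.sum_nonneg fun i _ => gap_nonneg μ hK hKN i)

lemma badArms_eq_empty_of_eq (μ : Fin N → ℝ) (hK : 0 < K) (hKN : K ≤ N) (h : K = N) :
    badArms μ K hK hKN 0 = ∅ := by
  refine Finset.filter_eq_empty_iff.2 fun i _ => ?_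
  have := Tuple.monotone_sort μ
    (show (⟨N - K, by omega⟩ : Fin N) ≤ (Tuple.sort μ).symm i from
      Fin.mk_le_of_le_val (by omega))
  simp only [Function.comp_apply, Equiv.apply_symm_apply] at this
  simpa [kthLargest] using this

end StaticProblem

namespace DuelingULCB

variable {K N : ℕ} (A : DuelingULCB K N) (α σ : ℝ)

/-- Without deviations, the regret of an epoch is at most the width of the confidence interval
of the pulled arm. -/
lemma maxMin_sub_minReward_le_bonus (hK : 0 < K) (hKN : K ≤ N) {μ : Fin N → ℝ} {s : State N}
    {n : ℕ} (hn : N ≤ n) (hs : ¬ Deviates α σ μ s (n + 1)) :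
    maxMin (fun _ : Fin K => μ) - minReward (fun _ => μ) (A.alloc α σ s n) ≤
      2 * s.bonus α σ (n + 1) (A.arm α σ s n) := by
  have : Nonempty (Fin K) := ⟨⟨0, hK⟩⟩
  have : Nonempty (Allocation K N) := ⟨Fin.castLEEmb hKN⟩
  simp only [Deviates, not_exists, not_lt, abs_le] at hs
  have hucb (i : Fin N) : μ i ≤ s.ucb α σ (n + 1) i := by
    have := (hs i).1
    unfold State.ucb
    linarith
  have hlcb (i : Fin N) : s.lcb α σ (n + 1) i ≤ μ i := by
    have := (hs i).2
    unfold State.lcb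
    linarith
  have hn' : ¬ n < N := not_lt.2 hn
  have h1 : maxMin (fun _ : Fin K => μ) ≤ s.ucb α σ (n + 1) (A.arm α σ s n) := by
    refine ciSup_le fun φ => ?_
    calc minReward (fun _ => μ) φ ≤ minReward (fun _ i => s.ucb α σ (n + 1) i) φ :=
          ciInf_mono (Set.finite_range _).bddBelow fun j => hucb (φ j)
      _ ≤ minReward (fun _ i => s.ucb α σ (n + 1) i) (A.alloc α σ s n) := by
          simpa only [alloc, hn', dif_neg, not_false_eq_true] using
            A.oracle₁_max (fun _ i => s.ucb α σ (n + 1) i) φ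
      _ ≤ _ := by
          simp only [arm, hn', dif_neg, not_false_eq_true]
          exact minReward_le _ _ _
  have h2 : s.lcb α σ (n + 1) (A.arm α σ s n) ≤ minReward (fun _ => μ) (A.alloc α σ s n) := by
    refine le_ciInf fun j => le_trans ?_ (hlcb _)
    simp only [arm, hn', dif_neg, not_false_eq_true]
    exact A.oracle₂_min _ (fun _ i => s.lcb α σ (n + 1) i) j
  unfold State.ucb at h1
  unfold State.lcb at h2
  linarith

variable (X : ℕ → Fin N → ℝ)

lemma run_succ_count (n : ℕ) (i : Fin N) :
    (A.run α σ X (n + 1)).count i = (A.run α σ X n).count i +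
      if i = A.arm α σ (A.run α σ X n) n then 1 else 0 := by
  simp only [run, State.pull]
  split_ifs <;> rfl

lemma sum_count_run (n : ℕ) : ∑ i, (A.run α σ X n).count i = n := by
  induction n with
  | zero => simp [run, State.init]
  | succ n ih => simp [run_succ_count, Finset.sum_add_distrib, ih]

lemma count_run_initOrder_pos (n : ℕ) (k : Fin N) (hk : (k : ℕ) < n) :
    0 < (A.run α σ X n).count (A.initOrder k) := by
  induction n with
  | zero => omega
  | succ n ih =>
    rw [run_succ_count]
    rcases Nat.lt_succ_iff_lt_or_eq.1 hk with h | h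
    · exact Nat.add_pos_left (ih h) _
    · have : A.arm α σ (A.run α σ X n) n = A.initOrder k := by
        subst h
        simp [arm]
      simp [this]

lemma count_run_pos {n : ℕ} (hn : N ≤ n) (i : Fin N) : 0 < (A.run α σ X n).count i := by
  have := A.count_run_initOrder_pos α σ X n (A.initOrder.symm i) (by omega)
  simpa using this

lemma count_run_le (n : ℕ) (i : Fin N) : (A.run α σ X n).count i ≤ n := by
  conv_rhs => rw [← A.sum_count_run α σ X n]
  exact Finset.single_le_sum (f := (A.run α σ X n).count) (fun _ _ => Nat.zero_le _)
    (Finset.mem_univ i)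

lemma sqrt_inv_le_two_mul_sub {c : ℝ} (hc : 1 ≤ c) : √(1 / c) ≤ 2 * √c - 2 * √(c - 1) := by
  have h0 : 0 < √c := Real.sqrt_pos.2 (by linarith)
  have h1 := Real.sqrt_nonneg (c - 1)
  have h2 : √c ^ 2 = c := Real.sq_sqrt (by linarith)
  have h3 : √(c - 1) ^ 2 = c - 1 := Real.sq_sqrt (by linarith)
  rw [Real.sqrt_div zero_le_one, Real.sqrt_one, div_le_iff₀ h0]
  nlinarith [sq_nonneg (√c - √(c - 1))]

lemma sum_sqrt_inv_count_le {T : ℕ} (hT : N ≤ T) :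
    ∑ n ∈ Finset.Ico N T,
        √(1 / ((A.run α σ X n).count (A.arm α σ (A.run α σ X n) n) : ℝ)) ≤
      ∑ i, 2 * √((A.run α σ X T).count i - 1) := by
  induction T, hT using Nat.le_induction with
  | base => simpa using Finset.sum_nonneg fun i _ => by positivity
  | succ T hT ih =>
    rw [Finset.sum_Ico_succ_top hT]
    refine le_trans (add_le_add_left ih _) ?_
    rw [← le_sub_iff_add_le', ← Finset.sum_sub_distrib]
    set a := A.arm α σ (A.run α σ X T) T with ha
    have hmono (i : Fin N) : 0 ≤ 2 * √(((A.run α σ X (T + 1)).count i : ℝ) - 1) -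
        2 * √(((A.run α σ X T).count i : ℝ) - 1) := by
      have : ((A.run α σ X T).count i : ℝ) ≤ (A.run α σ X (T + 1)).count i := by
        rw [run_succ_count]
        exact_mod_cast Nat.le_add_right _ _
      have := Real.sqrt_le_sqrt (sub_le_sub_right this 1)
      linarith
    refine le_trans ?_ (Finset.single_le_sum (fun i _ => hmono i) (Finset.mem_univ a))
    have hc : (1 : ℝ) ≤ (A.run α σ X T).count a := by
      exact_mod_cast A.count_run_pos α σ X hT a
    have : ((A.run α σ X (T + 1)).count a : ℝ) - 1 = (A.run α σ X T).count a := by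
      rw [run_succ_count, if_pos ha]
      push_cast
      ring
    rw [this]
    exact sqrt_inv_le_two_mul_sub hc

lemma sum_sqrt_count_le {T : ℕ} (hT : N ≤ T) :
    ∑ i, √((A.run α σ X T).count i - 1) ≤ √(N * T) := by
  refine Real.le_sqrt_of_sq_le ?_
  refine sq_sum_le_card_mul_sum_sq.trans ?_
  simp only [Finset.card_univ, Fintype.card_fin]
  refine mul_le_mul_of_nonneg_left ?_ (Nat.cast_nonneg _)
  calc ∑ i, √(((A.run α σ X T).count i : ℝ) - 1) ^ 2
      ≤ ∑ i, ((A.run α σ X T).count i : ℝ) := by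
        refine Finset.sum_le_sum fun i _ => ?_
        have hc : (1 : ℝ) ≤ (A.run α σ X T).count i := by
          exact_mod_cast A.count_run_pos α σ X hT i
        rw [Real.sq_sqrt (by linarith)]
        linarith
    _ = T := by exact_mod_cast A.sum_count_run α σ X T

lemma sum_bonus_le (hα : 0 ≤ α) {T : ℕ} (hT : N ≤ T) :
    ∑ n ∈ Finset.Ico N T,
        (A.run α σ X n).bonus α σ (n + 1) (A.arm α σ (A.run α σ X n) n) ≤
      √(N * (8 * σ ^ 2 * α * T * Real.log T)) := by
  have hlog : 0 ≤ Real.log T := Real.log_natCast_nonneg T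
  calc _ ≤ ∑ n ∈ Finset.Ico N T,
        √(1 / ((A.run α σ X n).count (A.arm α σ (A.run α σ X n) n) : ℝ)) *
          √(2 * σ ^ 2 * (α * Real.log T)) := by
        refine Finset.sum_le_sum fun n hn => ?_
        rw [State.bonus, Real.sqrt_mul (by positivity)]
        refine mul_le_mul_of_nonneg_left (Real.sqrt_le_sqrt ?_) (Real.sqrt_nonneg _)
        refine mul_le_mul_of_nonneg_left ?_ (by positivity)
        have hpos : (0 : ℝ) < ((n + 1 : ℕ) : ℝ) := by positivity
        rw [Real.log_rpow hpos]
        refine mul_le_mul_of_nonneg_left (Real.log_le_log hpos ?_) hα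
        exact_mod_cast (Finset.mem_Ico.1 hn).2
    _ ≤ (2 * √(N * T)) * √(2 * σ ^ 2 * (α * Real.log T)) := by
        rw [← Finset.sum_mul]
        refine mul_le_mul_of_nonneg_right ?_ (Real.sqrt_nonneg _)
        refine (A.sum_sqrt_inv_count_le α σ X hT).trans ?_
        rw [← Finset.mul_sum]
        exact mul_le_mul_of_nonneg_left (A.sum_sqrt_count_le α σ X hT) zero_le_two
    _ = √(N * (8 * σ ^ 2 * α * T * Real.log T)) := by
        rw [mul_assoc, ← Real.sqrt_mul (by positivity), ← Real.sqrt_sq zero_le_two,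
          ← Real.sqrt_mul (by positivity), Real.sqrt_sq zero_le_two]
        congr 1
        ring

open Classical in
/-- Pathwise regret bound. -/
lemma cumRegret_le (hK : 0 < K) (hKN : K ≤ N) (hα : 0 ≤ α) (μ : Fin N → ℝ) {T : ℕ}
    (hT : N ≤ T) :
    A.cumRegret α σ (fun _ => μ) X T ≤
      N * ∑ i ∈ badArms μ K hK hKN 0, gap μ K hK hKN i +
        2 * √(N * (8 * σ ^ 2 * α * T * Real.log T)) +
        ∑ n ∈ Finset.Ico N T, if Deviates α σ μ (A.run α σ X n) (n + 1) then
          ∑ i ∈ badArms μ K hK hKN 0, gap μ K hK hKN i else 0 := by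
  set D := ∑ i ∈ badArms μ K hK hKN 0, gap μ K hK hKN i
  rw [cumRegret, ← Finset.sum_range_add_sum_Ico _ hT, add_assoc]
  refine add_le_add ?_ ?_
  · refine (Finset.sum_le_card_nsmul _ _ D fun n _ =>
      maxMin_sub_minReward_le μ hK hKN _).trans ?_
    simp
  · refine le_trans ?_ (add_le_add_left (mul_le_mul_of_nonneg_left
      (A.sum_bonus_le α σ X hα hT) zero_le_two) _)
    rw [Finset.mul_sum, ← Finset.sum_add_distrib]
    refine Finset.sum_le_sum fun n hn => ?_
    split_ifs with hd
    · have : 0 ≤ (A.run α σ X n).bonus α σ (n + 1) (A.arm α σ (A.run α σ X n) n) :=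
        Real.sqrt_nonneg _
      have := maxMin_sub_minReward_le μ hK hKN (A.alloc α σ (A.run α σ X n) n)
      linarith
    · rw [add_zero]
      exact A.maxMin_sub_minReward_le_bonus α σ hK hKN (Finset.mem_Ico.1 hn).1 hd

lemma cumRegret_nonneg (ρ : Fin K → Fin N → ℝ) (T : ℕ) : 0 ≤ A.cumRegret α σ ρ X T :=
  Finset.sum_nonneg fun _ _ => sub_nonneg.2 (minReward_le_maxMin ρ _)

end DuelingULCB

end MaxMinBandit

namespace MaxMinBandit

section Deviation

variable {Ω : Type*} {K N : ℕ}

lemma MeasurableState.measurableSet_deviates {m : MeasurableSpace Ω} {s : Ω → State N}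
    (h : MeasurableState m s) (α σ : ℝ) (μ : Fin N → ℝ) (t : ℕ) :
    MeasurableSet {ω | Deviates α σ μ (s ω) t} := by
  simp only [Deviates, Set.ofPred_exists]
  exact MeasurableSet.iUnion fun i =>
    measurableSet_lt (h.bonus α σ t i) ((h.mean i).sub_const (μ i)).abs

variable [MeasurableSpace Ω] {P : Measure Ω} [IsProbabilityMeasure P]
  {ε : ℕ → Ω → Fin N → ℝ} {σ : ℝ≥0}

lemma measureReal_deviates_le (hmeas : ∀ t, Measurable (ε t)) (hindep : iIndepFun ε P)
    (hsub : ∀ t i, HasSubgaussianMGF (fun ω => ε t ω i) (σ ^ 2) P) (hσ : 0 < σ)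
    (A : DuelingULCB K N) {α : ℝ} (hα : 0 ≤ α) (μ : Fin N → ℝ) {n : ℕ} (hn : N ≤ n) :
    P.real {ω | Deviates α σ μ (A.run α σ (fun t i => μ i + ε t ω i) n) (n + 1)} ≤
      2 * N * ((n + 1 : ℕ) : ℝ) ^ (1 - α) := by
  have hσ' : (0 : ℝ) < σ := hσ
  have hpos : (0 : ℝ) < ((n + 1 : ℕ) : ℝ) := by positivity
  set L := Real.log (((n + 1 : ℕ) : ℝ) ^ α) with hL
  have hL0 : 0 ≤ L := Real.log_nonneg
    (Real.one_le_rpow (by exact_mod_cast Nat.succ_le_succ n.zero_le) hα)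
  have hexp : Real.exp (-L) = ((n + 1 : ℕ) : ℝ) ^ (-α) := by
    rw [Real.exp_neg, hL, Real.exp_log (by positivity), Real.rpow_neg hpos.le]
  let E (i : Fin N) (l : ℝ) : Set Ω :=
    {ω | Real.exp L ≤ expPot σ l (μ i) (A.run α σ (fun t i => μ i + ε t ω i) n) i}
  let l (c : ℕ) : ℝ := √(2 * L / (c * (σ : ℝ) ^ 2))
  have hsubset : {ω | Deviates α σ μ (A.run α σ (fun t i => μ i + ε t ω i) n) (n + 1)} ⊆
      ⋃ i ∈ (Finset.univ : Finset (Fin N)), ⋃ c ∈ Finset.Icc 1 n,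
        (E i (l c) ∪ E i (-l c)) := by
    rintro ω ⟨i, hi⟩
    have hc := A.count_run_pos α σ (fun t i => μ i + ε t ω i) hn i
    refine Set.mem_biUnion (Finset.mem_univ i) (Set.mem_biUnion
      (Finset.mem_Icc.2 ⟨hc, A.count_run_le α σ (fun t i => μ i + ε t ω i) n i⟩) ?_)
    exact exp_le_expPot_of_bonus_lt hσ' hL0 hc hi
  have hE (i : Fin N) (l : ℝ) : P.real (E i l) ≤ Real.exp (-L) :=
    measureReal_expPot_ge hmeas hindep hsub A α μ l L i n
  calc _ ≤ P.real (⋃ i ∈ (Finset.univ : Finset (Fin N)), ⋃ c ∈ Finset.Icc 1 n,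
        (E i (l c) ∪ E i (-l c))) := measureReal_mono hsubset (measure_ne_top P _)
    _ ≤ ∑ _i : Fin N, ∑ _c ∈ Finset.Icc 1 n, (Real.exp (-L) + Real.exp (-L)) := by
        refine (measureReal_biUnion_finset_le _ _).trans (Finset.sum_le_sum fun i _ => ?_)
        refine (measureReal_biUnion_finset_le _ _).trans (Finset.sum_le_sum fun c _ => ?_)
        exact (measureReal_union_le _ _).trans (add_le_add (hE _ _) (hE _ _))
    _ = 2 * N * (n * ((n + 1 : ℕ) : ℝ) ^ (-α)) := by
        simp only [Finset.sum_const, Finset.card_univ, Fintype.card_fin, Nat.card_Icc,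
          add_tsub_cancel_right, nsmul_eq_mul, hexp]
        ring
    _ ≤ 2 * N * ((n + 1 : ℕ) : ℝ) ^ (1 - α) := by
        refine mul_le_mul_of_nonneg_left ?_ (by positivity)
        rw [sub_eq_add_neg, Real.rpow_add hpos, Real.rpow_one]
        refine mul_le_mul_of_nonneg_right ?_ (by positivity)
        exact_mod_cast n.le_succ

end Deviation

lemma sum_rpow_one_sub_le {α : ℝ} (hα : 2 < α) (a : ℕ) :
    ∑ n ∈ Finset.range a, (1 + ((n + 1 : ℕ) : ℝ)) ^ (1 - α) ≤ 1 / (α - 2) := by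
  have hanti : AntitoneOn (fun x : ℝ => x ^ (1 - α)) (Set.Icc (1 : ℝ) (1 + a)) := by
    intro x hx y _ hxy
    exact Real.rpow_le_rpow_of_nonpos (by linarith [hx.1]) hxy (by linarith)
  refine hanti.sum_le_integral.trans ?_
  have hmem : (0 : ℝ) ∉ Set.uIcc (1 : ℝ) (1 + a) := by
    rw [Set.uIcc_of_le (by simp)]
    exact fun h => absurd h.1 (by norm_num)
  rw [integral_rpow (Or.inr ⟨by linarith, hmem⟩), Real.one_rpow,
    show 1 - α + 1 = -(α - 2) by ring, div_neg, ← neg_div, neg_sub]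
  refine div_le_div_of_nonneg_right ?_ (by linarith)
  have : (0 : ℝ) ≤ (1 + a : ℝ) ^ (-(α - 2)) := by positivity
  linarith

lemma sum_Ico_rpow_one_sub_le {α : ℝ} (hα : 2 < α) {N : ℕ} (hN : 1 ≤ N) (T : ℕ) :
    ∑ n ∈ Finset.Ico N T, ((n + 1 : ℕ) : ℝ) ^ (1 - α) ≤ 1 / (α - 2) := by
  refine le_trans ?_ (sum_rpow_one_sub_le hα (T - 1))
  refine (Finset.sum_le_sum_of_subset_of_nonneg (Finset.Ico_subset_Ico_left hN)
    fun n _ _ => by positivity).trans_eq ?_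
  rw [Finset.sum_Ico_eq_sum_range]
  refine Finset.sum_congr rfl fun n _ => ?_
  push_cast
  ring_nf

section Expectation

variable {Ω : Type*} {K N : ℕ} [MeasurableSpace Ω] {P : Measure Ω} [IsProbabilityMeasure P]
  {ε : ℕ → Ω → Fin N → ℝ}

lemma integrable_cumRegret (hmeas : ∀ t, Measurable (ε t)) (A : DuelingULCB K N) (α σ : ℝ)
    (μ : Fin N → ℝ) (ρ : Fin K → Fin N → ℝ) (T : ℕ) :
    Integrable (fun ω => A.cumRegret α σ ρ (fun t i => μ i + ε t ω i) T) P := by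
  refine integrable_finsetSum _ fun n _ => ?_
  let : MeasurableSpace (Allocation K N) := ⊤
  have hm : Measurable fun ω =>
      A.alloc α σ (A.run α σ (fun t i => μ i + ε t ω i) n) n :=
    measurable_to_countable' fun φ =>
      ((measurableState_run A α σ μ ε n).mono (history_le hmeas n)).measurableSet_alloc
        A α σ n φ
  have hf : Measurable fun φ : Allocation K N => maxMin ρ - minReward ρ φ := measurable_from_top
  obtain ⟨C, hC⟩ := (Set.finite_range
    fun φ : Allocation K N => ‖maxMin ρ - minReward ρ φ‖).bddAbove
  exact Integrable.of_bound (hf.comp hm).aestronglyMeasurable C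
    (ae_of_all _ fun ω => hC ⟨_, rfl⟩)

variable {σ : ℝ≥0}

open Classical in
/-- Regret bound with a leading constant of order `√N`. -/
lemma integral_cumRegret_le (hmeas : ∀ t, Measurable (ε t)) (hindep : iIndepFun ε P)
    (hsub : ∀ t i, HasSubgaussianMGF (fun ω => ε t ω i) (σ ^ 2) P) (hσ : 0 < σ)
    (hK : 0 < K) (hKN : K ≤ N) (A : DuelingULCB K N) {α : ℝ} (hα : 2 < α) (μ : Fin N → ℝ)
    {T : ℕ} (hT : N ≤ T) :
    ∫ ω, A.cumRegret α σ (fun _ => μ) (fun t i => μ i + ε t ω i) T ∂P ≤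
      2 * √(N * (8 * (σ : ℝ) ^ 2 * α * T * Real.log T)) +
        (N * α / (α - 2)) * ∑ i ∈ badArms μ K hK hKN 0, gap μ K hK hKN i := by
  have hα0 : 0 < α - 2 := by linarith
  set D := ∑ i ∈ badArms μ K hK hKN 0, gap μ K hK hKN i with hD
  have hD0 : 0 ≤ D := Finset.sum_nonneg fun i _ => gap_nonneg μ hK hKN i
  set B := 2 * √(N * (8 * (σ : ℝ) ^ 2 * α * T * Real.log T))
  let S (n : ℕ) : Set Ω :=
    {ω | Deviates α σ μ (A.run α σ (fun t i => μ i + ε t ω i) n) (n + 1)}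
  have hS (n : ℕ) : MeasurableSet (S n) :=
    ((measurableState_run A α σ μ ε n).mono
      (history_le hmeas n)).measurableSet_deviates α σ μ (n + 1)
  have hint (n : ℕ) : Integrable ((S n).indicator fun _ => D) P :=
    (integrable_const D).indicator (hS n)
  have hint' : Integrable (fun ω => ∑ n ∈ Finset.Ico N T, (S n).indicator (fun _ => D) ω) P :=
    integrable_finsetSum _ fun n _ => hint n
  have hpath (ω : Ω) : A.cumRegret α σ (fun _ => μ) (fun t i => μ i + ε t ω i) T ≤
      (N * D + B) + ∑ n ∈ Finset.Ico N T, (S n).indicator (fun _ => D) ω := by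
    refine (A.cumRegret_le α σ _ hK hKN (by linarith) μ hT).trans_eq ?_
    simp only [S, Set.indicator_apply, Set.mem_ofPred_eq, B, D]
  calc _ ≤ ∫ ω, ((N * D + B) + ∑ n ∈ Finset.Ico N T, (S n).indicator (fun _ => D) ω) ∂P :=
        integral_mono (integrable_cumRegret hmeas A α σ μ _ T)
          ((integrable_const _).add hint') hpath
    _ = (N * D + B) + ∑ n ∈ Finset.Ico N T, P.real (S n) * D := by
        rw [integral_add (integrable_const _) hint', integral_finsetSum _ fun n _ => hint n]
        simp only [integral_indicator_const D (hS _), integral_const, probReal_univ, one_mul,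
          smul_eq_mul]
    _ ≤ (N * D + B) + 2 * N * (1 / (α - 2)) * D := by
        rw [← Finset.sum_mul]
        gcongr
        refine (Finset.sum_le_sum fun n hn => measureReal_deviates_le hmeas hindep hsub hσ A
          (by linarith) μ (Finset.mem_Ico.1 hn).1).trans ?_
        rw [← Finset.mul_sum]
        exact mul_le_mul_of_nonneg_left (sum_Ico_rpow_one_sub_le hα (hK.trans_le hKN) T)
          (by positivity)
    _ = B + (N * α / (α - 2)) * D := by
        field_simp
        ring

end Expectation

end MaxMinBandit

open MaxMinBandit in
theorem proposition2 {Ω : Type*} [MeasurableSpace Ω] (P : Measure Ω) [IsProbabilityMeasure P]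
    (K N : ℕ) (hK : 0 < K) (hKN : K ≤ N)
    (α : ℝ) (hα : 2 < α) (σ : ℝ≥0) (hσ : 0 < σ)
    (μ : Fin N → ℝ) (ε : ℕ → Ω → Fin N → ℝ)
    (hmeas : ∀ t, Measurable (ε t))
    (hindep : iIndepFun ε P)
    (hident : ∀ s t, IdentDistrib (ε s) (ε t) P P)
    (hsub : ∀ t i, HasSubgaussianMGF (fun ω => ε t ω i) (σ ^ 2) P)
    (A : MaxMinBandit.DuelingULCB K N) :
    (∀ T : ℕ, N < T →
      Integrable (fun ω => A.cumRegret α σ (fun _ => μ) (fun t i => μ i + ε t ω i) T) P ∧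
      ∫ ω, A.cumRegret α σ (fun _ => μ) (fun t i => μ i + ε t ω i) T ∂P ≤
        2 * √((((N : ℝ) - K + 1) ^ 2 - 1) * K * 8 * (σ : ℝ) ^ 2 * α * T * Real.log T) +
          ∑ i ∈ MaxMinBandit.badArms μ K hK hKN 0,
            (2 * K * MaxMinBandit.gap μ K hK hKN i * α / (α - 2) +
              ((N : ℝ) - K) * K * MaxMinBandit.gap μ K hK hKN i * α / (α - 2))) ∧
    (fun T : ℕ => ∫ ω, A.cumRegret α σ (fun _ => μ) (fun t i => μ i + ε t ω i) T ∂P)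
      =O[atTop] (fun T : ℕ => √((T : ℝ) * Real.log T)) := by
  have hα0 : 0 < α - 2 := by linarith
  have hD0 : 0 ≤ ∑ i ∈ badArms μ K hK hKN 0, gap μ K hK hKN i :=
    Finset.sum_nonneg fun i _ => gap_nonneg μ hK hKN i
  refine ⟨fun T hT => ⟨integrable_cumRegret hmeas A α σ μ _ T, ?_⟩, ?_⟩
  · rcases hKN.eq_or_lt with h | h
    · have hB := badArms_eq_empty_of_eq μ hK hKN h
      have hle (ω : Ω) :
          A.cumRegret α σ (fun _ => μ) (fun t i => μ i + ε t ω i) T ≤ 0 := by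
        refine Finset.sum_nonpos fun n _ => (maxMin_sub_minReward_le μ hK hKN _).trans_eq ?_
        rw [hB, Finset.sum_empty]
      refine (integral_nonpos hle).trans ?_
      rw [hB, Finset.sum_empty, add_zero]
      positivity
    · have hK1 : (1 : ℝ) ≤ K := by exact_mod_cast hK
      obtain ⟨M, rfl⟩ := Nat.exists_eq_add_of_lt h
      have hM : (0 : ℝ) ≤ M := M.cast_nonneg
      have hKM : 0 ≤ ((K : ℝ) - 1) * M := mul_nonneg (by linarith) hM
      have hlog : 0 ≤ Real.log T := Real.log_natCast_nonneg T
      refine (integral_cumRegret_le hmeas hindep hsub hσ hK hKN A hα μ hT.le).trans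
        (add_le_add ?_ ?_)
      · refine mul_le_mul_of_nonneg_left (Real.sqrt_le_sqrt ?_) zero_le_two
        calc _ ≤ (((((K + M + 1 : ℕ) : ℝ) - K + 1) ^ 2 - 1) * K) *
              (8 * (σ : ℝ) ^ 2 * α * T * Real.log T) := by
              refine mul_le_mul_of_nonneg_right ?_ (by positivity)
              push_cast
              nlinarith [mul_nonneg (mul_nonneg hM hM) (zero_le_one.trans hK1)]
          _ = _ := by ring
      · rw [Finset.mul_sum]
        refine Finset.sum_le_sum fun i _ => ?_
        have hg := gap_nonneg μ hK hKN i
        calc _ = ((K + M + 1 : ℕ) : ℝ) * (gap μ K hK hKN i * (α / (α - 2))) := by ring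
          _ ≤ ((2 + (((K + M + 1 : ℕ) : ℝ) - K)) * K) * (gap μ K hK hKN i * (α / (α - 2))) := by
              refine mul_le_mul_of_nonneg_right ?_
                (mul_nonneg hg (div_nonneg (by linarith) hα0.le))
              push_cast
              nlinarith
          _ = _ := by ring
  · refine IsBigO.of_bound (2 * √(N * (8 * (σ : ℝ) ^ 2 * α)) +
      (N * α / (α - 2)) * ∑ i ∈ badArms μ K hK hKN 0, gap μ K hK hKN i) ?_
    filter_upwards [eventually_ge_atTop N, eventually_ge_atTop 3] with T hT hT3
    have hT3' : (3 : ℝ) ≤ T := by exact_mod_cast hT3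
    have hlog : 1 ≤ Real.log T := by
      rw [Real.le_log_iff_exp_le (by linarith)]
      linarith [Real.exp_one_lt_d9]
    have hone : 1 ≤ √((T : ℝ) * Real.log T) := Real.one_le_sqrt.2 (by nlinarith)
    rw [Real.norm_of_nonneg (integral_nonneg fun ω => A.cumRegret_nonneg α σ _ _ T),
      Real.norm_of_nonneg (Real.sqrt_nonneg _), add_mul]
    refine (integral_cumRegret_le hmeas hindep hsub hσ hK hKN A hα μ hT).trans
      (add_le_add (le_of_eq ?_) ?_)
    · rw [mul_assoc 2 _ (√_), ← Real.sqrt_mul (by positivity)]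
      ring_nf
    · exact le_mul_of_one_le_right
        (mul_nonneg (div_nonneg (by positivity) hα0.le) hD0) hone
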